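/- All graphs are simple. A $2$-factor of a graph is a spanning $2$-regular subgraph. A finite graph is *pseudo $2$-factor isomorphic* if it has a $2$-factor and all its $2$-factors have the same parity of number of circuits. For $m\ge 0$ let $C(m)$ be the graph consisting of $m$ six-circuits $u_i^1u_i^2u_i^3u_i^4v_i^2v_i^1$ ($1\le i\le m$), linked by the edges $v_{i-1}^1u_i^1,\ v_{i-1}^2u_i^4,\ u_{i-1}^3u_i^2$ for $2\le i\le m$. For $n\ge 7$ let $D(n)$ be the following graph on $2n$ vertices. - If $n=3m$: $C(m)$ with the edges $u_1^1v_m^1,\ u_1^4v_m^2,\ u_1^2u_m^3$ added. - If $n=3m+1$: $C(m)$ with two new vertices $w^1,w^2$ and the edges $u_1^1w^1,\ u_1^2v_m^2,\ u_1^4w^2,\ w^1w^2,\ w^1u_m^3,\ w^2v_m^1$ added. - If $n=3m+2$: $C(m)$ with four new vertices $w^1,w^2,w^3,w^4$ and the edges $v_m^1w^1,\ v_m^2w^4,\ u_m^3w^2,\ u_1^1w^4,\ u_1^2w^1,\ u_1^4w^3,\ w^1w^2,\ w^2w^3,\ w^3w^4$ added. ($D(n)$ is the Levi graph, that is, the point-line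 incidence graph, of the cyclic $n_3$ configuration with base line $\{0,1,3\}$.) Let $G_T$ be the graph on the $20$ vertices $u^j,w^j,x^j,y^j,z^j,v^j$ ($j=1,2,3$), $t^1,t^2$ with the edges $u^1w^1,u^1w^2,u^2w^1,u^2w^3,u^3w^2,u^3w^3$; $w^jx^j,\ x^jt^1,\ x^jy^j,\ z^jv^j,\ v^jt^2$ ($j=1,2,3$); $y^1z^1,y^1z^2,y^2z^1,y^2z^3,y^3z^2,y^3z^3$. For $n\ge 1$ let $T(n)$ consist of $n$ copies of $G_T$ (the vertices of the $i$-th copy carrying the subscript $i$), linked by the edges $v_{i-1}^ju_i^j$ ($j=1,2,3$, $2\le i\le n$). Then $T_1(n)$, $T_2(n)$, $T_3(n)$ are obtained from $T(n)$ by adding respectively the edges $u_1^1v_n^1,u_1^2v_n^2,u_1^3v_n^3$; the edges $u_1^3v_n^1,u_1^2v_n^2,u_1^1v_n^3$; and the edges $u_1^1v_n^3,u_1^2v_n^1,u_1^3v_n^2$. The *Heawood graph* is the Levi graph of the Fano plane. The *Pappus graph* consists of a circuit $v_1v_2\cdots v_{18}$ and the chords $v_1v_6,v_2v_9,v_3v_{14},v_4v_{11},v_5v_{16},v_7v_{12},v_8v_{15},v_{10}v_{17},v_{13}v_{18}$.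 The *irreducible Levi graphs* of symmetric $n_3$ configurations are, up to isomorphism, the graphs on Boben's list: $D(n)$ for $n\ge 7$, $T_1(n),T_2(n),T_3(n)$ for $n\ge1$, and the Pappus graph. **Theorem 3.1.** The Heawood graph and the Pappus graph are irreducible Levi graphs and are pseudo $2$-factor isomorphic, and, up to isomorphism, they are the only irreducible Levi graphs that are pseudo $2$-factor isomorphic. Moreover, every graph of the infinite families $D(n)$ ($n\ge7$), $T_1(n)$, $T_2(n)$, $T_3(n)$ ($n\ge1$) that is not isomorphic to the Heawood graph has a Hamiltonian $2$-factor (one that is a single circuit) and a $2$-factor with exactly two circuits. -/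

import Mathlib

/-- `F` is a 2-factor of `G`: a spanning subgraph of `G` in which every vertex has exactly two
neighbours. -/
def IsTwoFactor {V : Type*} (G F : SimpleGraph V) : Prop :=
  F ≤ G ∧ ∀ v : V, (F.neighborSet v).ncard = 2

/-- The number of circuits of a 2-factor `F` of a finite graph. The circuits of a finite
2-regular graph are exactly its connected components. -/
noncomputable def numCircuits {V : Type*} (F : SimpleGraph V) : ℕ :=
  Nat.card F.ConnectedComponent

/-- `G` has a 2-factor, and all 2-factors of `G` have the same parity of number of circuits. -/
def IsPseudoTwoFactorIsomorphic {V : Type*} (G : SimpleGraph V) : Prop :=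
  (∃ F, IsTwoFactor G F) ∧
    ∀ F₁ F₂, IsTwoFactor G F₁ → IsTwoFactor G F₂ → (numCircuits F₁ ≡ numCircuits F₂ [MOD 2])

/-! ### The family `D(n)` -/

/-- The vertex labels in one segment (a 6-circuit) of `C(m)`: `uj` is `u_i^j`, `vj` is `v_i^j`. -/
inductive CLabel : Type
  | u1 | u2 | u3 | u4 | v1 | v2
  deriving DecidableEq

instance : Fintype CLabel :=
  ⟨{.u1, .u2, .u3, .u4, .v1, .v2}, fun a => by cases a <;> decide⟩

/-- The edges inside a segment of `C(m)`, each listed in one direction: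
the 6-circuit `u1 u2 u3 u4 v2 v1`. -/
def CLabel.seg : CLabel → CLabel → Bool
  | .u1, .u2 => true
  | .u2, .u3 => true
  | .u3, .u4 => true
  | .u4, .v2 => true
  | .v2, .v1 => true
  | .v1, .u1 => true
  | _, _ => false

/-- The edges from segment `i - 1` (first argument) to segment `i` (second argument). -/
def CLabel.link : CLabel → CLabel → Bool
  | .v1, .u1 => true
  | .v2, .u4 => true
  | .u3, .u2 => true
  | _, _ => false

/-- The edges of `D(3m + r)` from the last segment of `C(m)` (first label) to the first segment
of `C(m)` (second label). -/
def CLabel.close : ℕ → CLabel → CLabel → Bool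
  | 0, .v1, .u1 => true
  | 0, .v2, .u4 => true
  | 0, .u3, .u2 => true
  | 1, .v2, .u2 => true
  | _, _, _ => false

/-- The edges of `D(3m + r)` from the first segment of `C(m)` to the additional vertices
`w^1, w^2, ...` of `D(3m + r)`; the number `k` stands for `w^(k+1)`. -/
def CLabel.firstW : ℕ → CLabel → ℕ → Bool
  | 1, .u1, 0 => true
  | 1, .u4, 1 => true
  | 2, .u1, 3 => true
  | 2, .u2, 0 => true
  | 2, .u4, 2 => true
  | _, _, _ => false

/-- The edges of `D(3m + r)` from the last segment of `C(m)` to the additional vertices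
`w^1, w^2, ...` of `D(3m + r)`; the number `k` stands for `w^(k+1)`. -/
def CLabel.lastW : ℕ → CLabel → ℕ → Bool
  | 1, .u3, 0 => true
  | 1, .v1, 1 => true
  | 2, .v1, 0 => true
  | 2, .v2, 3 => true
  | 2, .u3, 1 => true
  | _, _, _ => false

/-- The edges of `D(3m + r)`, each listed in one direction. The vertices are those of `m` segments
(numbered from `0` to `m - 1`) and `2r` additional vertices `w^1, ..., w^(2r)`, which form a path
(numbered from `0` to `2r - 1`). -/
def dRel (m r : ℕ) :
    (Fin m × CLabel) ⊕ Fin (2 * r) → (Fin m × CLabel) ⊕ Fin (2 * r) → Prop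
  | .inl p, .inl q =>
      (p.1 = q.1 ∧ p.2.seg q.2 = true) ∨
      (p.1.val + 1 = q.1.val ∧ p.2.link q.2 = true) ∨
      (p.1.val + 1 = m ∧ q.1.val = 0 ∧ CLabel.close r p.2 q.2 = true)
  | .inl p, .inr k =>
      (p.1.val = 0 ∧ CLabel.firstW r p.2 k.val = true) ∨
      (p.1.val + 1 = m ∧ CLabel.lastW r p.2 k.val = true)
  | .inr _, .inl _ => False
  | .inr k, .inr l => k.val + 1 = l.val

/-- The graph `D(n)` on `2n` vertices, built from `C(m)` with `n = 3m + r`, `r < 3`. -/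
def graphD (n : ℕ) : SimpleGraph ((Fin (n / 3) × CLabel) ⊕ Fin (2 * (n % 3))) :=
  SimpleGraph.fromRel (dRel (n / 3) (n % 3))

/-! ### The families `T_1(n)`, `T_2(n)`, `T_3(n)` -/

/-- The vertex labels in one segment `G_T`. -/
inductive TLabel : Type
  | u1 | u2 | u3 | w1 | w2 | w3 | x1 | x2 | x3 | y1 | y2 | y3 | z1 | z2 | z3
  | v1 | v2 | v3 | t1 | t2
  deriving DecidableEq

instance : Fintype TLabel :=
  ⟨{.u1, .u2, .u3, .w1, .w2, .w3, .x1, .x2, .x3, .y1, .y2, .y3, .z1, .z2, .z3,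
    .v1, .v2, .v3, .t1, .t2}, fun a => by cases a <;> decide⟩

/-- The edges of the segment graph `G_T`, each listed in one direction. -/
def TLabel.seg : TLabel → TLabel → Bool
  | .u1, .w1 => true
  | .u1, .w2 => true
  | .u2, .w1 => true
  | .u2, .w3 => true
  | .u3, .w2 => true
  | .u3, .w3 => true
  | .w1, .x1 => true
  | .w2, .x2 => true
  | .w3, .x3 => true
  | .x1, .t1 => true
  | .x2, .t1 => true
  | .x3, .t1 => true
  | .x1, .y1 => true
  | .x2, .y2 => true
  | .x3, .y3 => true
  | .y1, .z1 => true
  | .y1, .z2 => true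
  | .y2, .z1 => true
  | .y2, .z3 => true
  | .y3, .z2 => true
  | .y3, .z3 => true
  | .z1, .v1 => true
  | .z2, .v2 => true
  | .z3, .v3 => true
  | .v1, .t2 => true
  | .v2, .t2 => true
  | .v3, .t2 => true
  | _, _ => false

/-- The edges between `v^1, v^2, v^3` of one segment and `u^1, u^2, u^3` of another one, with
equal superscripts. They link consecutive segments of `T(n)`, and close up `T_1(n)`. -/
def TLabel.close1 : TLabel → TLabel → Bool
  | .v1, .u1 => true
  | .v2, .u2 => true
  | .v3, .u3 => true
  | _, _ => false

/-- The edges of `T_2(n)` from its last segment to its first segment. -/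
def TLabel.close2 : TLabel → TLabel → Bool
  | .v1, .u3 => true
  | .v2, .u2 => true
  | .v3, .u1 => true
  | _, _ => false

/-- The edges of `T_3(n)` from its last segment to its first segment. -/
def TLabel.close3 : TLabel → TLabel → Bool
  | .v3, .u1 => true
  | .v1, .u2 => true
  | .v2, .u3 => true
  | _, _ => false

/-- The edges of `T(n)` together with the edges `close` from the last segment to the first one,
each listed in one direction. The `n` segments are numbered from `0` to `n - 1`. -/
def tRel (n : ℕ) (close : TLabel → TLabel → Bool) (p q : Fin n × TLabel) : Prop :=
  (p.1 = q.1 ∧ p.2.seg q.2 = true) ∨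
  (p.1.val + 1 = q.1.val ∧ p.2.close1 q.2 = true) ∨
  (p.1.val + 1 = n ∧ q.1.val = 0 ∧ close p.2 q.2 = true)

/-- The graph `T_1(n)`. -/
def graphT1 (n : ℕ) : SimpleGraph (Fin n × TLabel) :=
  SimpleGraph.fromRel (tRel n TLabel.close1)

/-- The graph `T_2(n)`. -/
def graphT2 (n : ℕ) : SimpleGraph (Fin n × TLabel) :=
  SimpleGraph.fromRel (tRel n TLabel.close2)

/-- The graph `T_3(n)`. -/
def graphT3 (n : ℕ) : SimpleGraph (Fin n × TLabel) :=
  SimpleGraph.fromRel (tRel n TLabel.close3)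

/-! ### The Heawood graph and the Pappus graph -/

/-- The Levi graph (incidence graph) of an incidence relation between points and lines. -/
def leviGraph {P L : Type*} (I : P → L → Prop) : SimpleGraph (P ⊕ L) :=
  SimpleGraph.fromRel fun a b => ∃ p l, a = Sum.inl p ∧ b = Sum.inr l ∧ I p l

/-- The Heawood graph: the Levi graph of the Fano plane, whose points are the residues modulo `7`
and whose lines are the translates `{l, l + 1, l + 3}` of `{0, 1, 3}`. -/
def heawoodGraph : SimpleGraph (ZMod 7 ⊕ ZMod 7) :=
  leviGraph fun p l : ZMod 7 => p = l ∨ p = l + 1 ∨ p = l + 3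

/-- The Pappus graph: a circuit `v_1 v_2 ... v_18` with nine chords; the residue `j` modulo `18`
stands for `v_j`. -/
def pappusGraph : SimpleGraph (ZMod 18) :=
  SimpleGraph.fromRel fun i j => j = i + 1 ∨
    (i, j) ∈ ([(1, 6), (2, 9), (3, 14), (4, 11), (5, 16), (7, 12), (8, 15), (10, 17), (13, 18)] :
      List (ZMod 18 × ZMod 18))

/-! ### Irreducible Levi graphs -/

/-- `G` is (isomorphic to) a member of one of the four infinite families of irreducible Levi
graphs: `D(n)` with `n ≥ 7` (the Levi graph of the cyclic `n_3` configuration with base line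
`{0, 1, 3}`, which exists only for `n ≥ 7`) and `T_1(n)`, `T_2(n)`, `T_3(n)` with `n ≥ 1`. -/
def InInfiniteFamilies {V : Type*} (G : SimpleGraph V) : Prop :=
  (∃ n : ℕ, 7 ≤ n ∧ Nonempty (G ≃g graphD n)) ∨
  (∃ n : ℕ, 1 ≤ n ∧ Nonempty (G ≃g graphT1 n)) ∨
  (∃ n : ℕ, 1 ≤ n ∧ Nonempty (G ≃g graphT2 n)) ∨
  (∃ n : ℕ, 1 ≤ n ∧ Nonempty (G ≃g graphT3 n))

/-- `G` is (isomorphic to) an irreducible Levi graph, that is, a graph on Boben's list. -/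
def IsIrreducibleLeviGraph {V : Type*} (G : SimpleGraph V) : Prop :=
  InInfiniteFamilies G ∨ Nonempty (G ≃g pappusGraph)

/-!
Suitable 2-factors of a short member of one of the infinite families extend to all longer members
without changing the number of circuits. The segment of `C(m)` is covered by three disjoint paths,
each leading from a port on the left to the corresponding port on the right, and `G_T` is covered by
two such paths (`dStrands`, `tStrands`). If a short graph of the family has a 2-factor with `c`
circuits in which the closing edges that are used are exactly those at the ends of these paths, then
inserting further segments there only subdivides edges of the circuits, and so every longer graph
with the same closing has a 2-factor with `c` circuits (`hasTwoFactorWith_of_glue`). The theorem on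
the families therefore reduces to finitely many pieces, whose circuits are listed explicitly (`dHam0` to `t3Two`) and checked by computation: one with one
circuit and one with two circuits for each of `T_1`, `T_2`, `T_3` and for `D` in each residue class
of `n` modulo `3`. Only the 2-factor with two circuits of `D(10)` does not come from this
construction and is given separately (`dTwo10`).

A graph with 2-factors of one and of two circuits is not pseudo 2-factor isomorphic. Up to
isomorphism this leaves `D(7)`, which is the Heawood graph, and the Pappus graph. In a cubic graph
the 2-factors are the complements of the perfect matchings, and a search through all perfect
matchings of these two graphs shows that the number of circuits is always odd
(`numCircuits_odd_of_search`).
-/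

/-! ### Two-factors with a prescribed number of circuits -/

/-- `G` has a 2-factor with exactly `c` circuits. -/
def HasTwoFactorWith {V : Type*} (G : SimpleGraph V) (c : ℕ) : Prop :=
  ∃ F, IsTwoFactor G F ∧ numCircuits F = c

theorem numCircuits_comap {V W : Type*} (f : V ≃ W) (F : SimpleGraph W) :
    numCircuits (F.comap f) = numCircuits F :=
  Nat.card_congr (SimpleGraph.Iso.comap f F).connectedComponentEquiv

theorem IsTwoFactor.comap {V W : Type*} {G : SimpleGraph V} {G' : SimpleGraph W} (f : G ≃g G')
    {F : SimpleGraph W} (h : IsTwoFactor G' F) : IsTwoFactor G (F.comap f) := by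
  refine ⟨fun a b hab => f.map_rel_iff.1 (h.1 hab), fun v => ?_⟩
  rw [← h.2 (f v)]
  exact Set.ncard_preimage_of_injective_subset_range f.injective
    (by rw [f.surjective.range_eq]; exact Set.subset_univ _)

theorem HasTwoFactorWith.of_iso {V W : Type*} {G : SimpleGraph V} {G' : SimpleGraph W}
    (f : G ≃g G') {c : ℕ} (h : HasTwoFactorWith G' c) : HasTwoFactorWith G c := by
  obtain ⟨F, hF, hc⟩ := h
  exact ⟨F.comap f, hF.comap f, (numCircuits_comap f.toEquiv F).trans hc⟩

theorem IsPseudoTwoFactorIsomorphic.of_iso {V W : Type*} {G : SimpleGraph V} {G' : SimpleGraph W}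
    (f : G ≃g G') (h : IsPseudoTwoFactorIsomorphic G') : IsPseudoTwoFactorIsomorphic G := by
  obtain ⟨⟨F, hF⟩, h2⟩ := h
  refine ⟨⟨F.comap f, hF.comap f⟩, fun F₁ F₂ h₁ h₂ => ?_⟩
  have := h2 _ _ (h₁.comap f.symm) (h₂.comap f.symm)
  rwa [show F₁.comap f.symm = F₁.comap f.symm.toEquiv from rfl,
    show F₂.comap f.symm = F₂.comap f.symm.toEquiv from rfl,
    numCircuits_comap, numCircuits_comap] at this

theorem connected_of_numCircuits_eq_one {V : Type*} {F : SimpleGraph V} (h : numCircuits F = 1) :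
    F.Connected := by
  obtain ⟨hs, ⟨c⟩⟩ := Nat.card_eq_one_iff_unique.1 h
  obtain ⟨v, -⟩ := c.exists_rep
  exact (SimpleGraph.connected_iff F).2
    ⟨fun a b => SimpleGraph.ConnectedComponent.exact (hs.elim _ _), ⟨v⟩⟩

/-- A labelling of the vertices that is constant along edges, takes every value, and takes equal
values only on vertices that can be joined, has as many values as there are components. -/
theorem numCircuits_eq_card {V κ : Type*} [Fintype κ] {F : SimpleGraph V} (lab : V → κ)
    (hadj : ∀ a b, F.Adj a b → lab a = lab b) (hsurj : Function.Surjective lab)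
    (hreach : ∀ a b, lab a = lab b → F.Reachable a b) : numCircuits F = Fintype.card κ := by
  have hlab : ∀ a b, F.Reachable a b → lab a = lab b := by
    rintro a b ⟨p⟩
    induction p with
    | nil => rfl
    | cons h _ ih => exact (hadj _ _ h).trans ih
  rw [← Nat.card_eq_fintype_card]
  refine Nat.card_congr (Equiv.ofBijective
    (Quot.lift lab hlab : F.ConnectedComponent → κ) ⟨?_, ?_⟩)
  · rintro ⟨a⟩ ⟨b⟩ h
    exact SimpleGraph.ConnectedComponent.sound (hreach a b h)
  · intro i
    obtain ⟨a, rfl⟩ := hsurj i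
    exact ⟨F.connectedComponentMk a, rfl⟩

/-- The graph in which every vertex `a` is adjacent to `N a true` and `N a false`. -/
def nbrGraph {V : Type*} (N : V → Bool → V) : SimpleGraph V :=
  SimpleGraph.fromRel fun a b => ∃ e, N a e = b

section nbrGraph

variable {V : Type*} {N : V → Bool → V}

theorem nbrGraph_adj (hsymm : ∀ a e, ∃ e', N (N a e) e' = a) (hirr : ∀ a e, N a e ≠ a) {a b : V} :
    (nbrGraph N).Adj a b ↔ ∃ e, N a e = b := by
  rw [nbrGraph, SimpleGraph.fromRel_adj]
  constructor
  · rintro ⟨-, h | ⟨e, rfl⟩⟩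
    · exact h
    · exact hsymm b e
  · rintro ⟨e, rfl⟩
    exact ⟨(hirr a e).symm, Or.inl ⟨e, rfl⟩⟩

theorem isTwoFactor_nbrGraph {G : SimpleGraph V} (hsymm : ∀ a e, ∃ e', N (N a e) e' = a)
    (hne : ∀ a, N a true ≠ N a false) (hG : ∀ a e, G.Adj a (N a e)) :
    IsTwoFactor G (nbrGraph N) := by
  have hadj := fun {a b} => nbrGraph_adj (a := a) (b := b) hsymm fun a e => (hG a e).ne'
  refine ⟨fun a b h => ?_, fun a => ?_⟩
  · obtain ⟨e, rfl⟩ := hadj.1 h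
    exact hG a e
  · rw [show (nbrGraph N).neighborSet a = {N a true, N a false} from ?_, Set.ncard_pair (hne a)]
    ext b
    rw [SimpleGraph.mem_neighborSet, hadj]
    simp [eq_comm, or_comm]

end nbrGraph

/-- All entries of a list are joined to each other if consecutive entries are. -/
theorem reachable_of_isChain {V : Type*} {F : SimpleGraph V} {l : List V}
    (h : l.IsChain F.Reachable) {a b : V} (ha : a ∈ l) (hb : b ∈ l) : F.Reachable a b := by
  have : IsTrans V F.Reachable := ⟨fun _ _ _ h₁ h₂ => h₁.trans h₂⟩
  have : Std.Symm F.Reachable := ⟨fun _ _ h => h.symm⟩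
  exact List.Pairwise.forall_of_forall (fun x _ => SimpleGraph.Reachable.refl x)
    (List.isChain_iff_pairwise.1 h) ha hb

/-! ### Gluing pieces of a 2-factor along strands -/

/-- An entry in the description of how the circuits of a 2-factor run through a piece of a graph
with vertex set `X` and `s` ports on either side: a vertex `vert x`, leaving the piece through its
right port `j` (`fwd j`), or leaving it through its left port `j` (`back j`). -/
inductive Step (X : Type*) (s : ℕ) : Type _
  | vert (x : X)
  | fwd (j : Fin s)
  | back (j : Fin s)
  deriving DecidableEq

/-- The same passage between pieces, traversed in the opposite direction and seen from the piece
at its other end. -/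
def Step.flip {X : Type*} {s : ℕ} : Step X s → Step X s
  | vert x => vert x
  | fwd j => back j
  | back j => fwd j

/-- The entries before and after the first occurrence of `vert x` that is neither the first nor the
last entry of a list. -/
def Step.around {X : Type*} [DecidableEq X] {s : ℕ} (x : X) :
    List (Step X s) → Option (Step X s × Step X s)
  | a :: b :: c :: l => if b = vert x then some (a, c) else around x (b :: c :: l)
  | _ => none

/-- A piece of a graph, with `s` ports `left j` and `s` ports `right j`, together with `m` circuits
of the graph that arises if each port `right j` is joined to `left j`. A circuit is a cyclic list,
in which `fwd j` marks a passage from `right j` to `left j`, and `back j` one from `left j` to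
`right j`. -/
structure Piece (X : Type*) (s m : ℕ) where
  /-- The ports on the left. -/
  left : Fin s → X
  /-- The ports on the right. -/
  right : Fin s → X
  /-- The circuits. -/
  circ : Fin m → List (Step X s)

namespace Piece

variable {X : Type*} [DecidableEq X] {s m : ℕ}

/-- The successor (for `true`) and the predecessor (for `false`) of the vertex `x` on its circuit.
The passages are written from the point of view of `x`: if `x = left j` is preceded by `fwd j`,
then its predecessor is `back j`. The circuits are extended by their first two entries, so that
every entry has a neighbour on either side; the default value is not used if the circuits cover the
piece. -/
def step (P : Piece X s m) (x : X) (e : Bool) : Step X s :=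
  let p := ((List.finRange m).findSome? fun i =>
    Step.around x (P.circ i ++ (P.circ i).take 2)).getD (.vert x, .vert x)
  bif e then p.2 else p.1.flip

/-- The vertex of the piece to which an entry of a circuit belongs. -/
def base (P : Piece X s m) : Step X s → X
  | .vert x => x
  | .fwd j => P.right j
  | .back j => P.left j

/-- The circuits of `P` are disjoint and cover the piece, and the neighbours of every vertex
on its circuit are as they should be in a 2-factor. -/
structure IsValid (P : Piece X s m) : Prop where
  cover : ∀ x, ∃ i, .vert x ∈ P.circ i
  disjoint : ∀ x i i', .vert x ∈ P.circ i → .vert x ∈ P.circ i' → i = i'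
  nonempty : ∀ i, ∃ x, .vert x ∈ P.circ i
  step_ne : ∀ x, P.step x true ≠ P.step x false
  exists_vert : ∀ x, ∃ e y, P.step x e = .vert y
  symm : ∀ x e y, P.step x e = .vert y → ∃ e', P.step y e' = .vert x
  same : ∀ x e y, P.step x e = .vert y → ∀ i, .vert x ∈ P.circ i → .vert y ∈ P.circ i
  eq_right : ∀ x e j, P.step x e = .fwd j → x = P.right j
  eq_left : ∀ x e j, P.step x e = .back j → x = P.left j
  exists_fwd : ∀ j, ∃ e, P.step (P.right j) e = .fwd j
  exists_back : ∀ j, ∃ e, P.step (P.left j) e = .back j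
  strand : ∀ i j, .vert (P.right j) ∈ P.circ i → .vert (P.left j) ∈ P.circ i

/-- A piece that consists of one path from `left j` to `right j` for each `j`. -/
structure IsStrands (P : Piece X s s) : Prop extends P.IsValid where
  left_mem : ∀ j, .vert (P.left j) ∈ P.circ j
  chain : ∀ j, ((P.circ j).map P.base).IsChain fun x y => x = y ∨ ∃ e, P.step x e = .vert y

/-- A piece such that joining `right j` to `left j` for all `j` gives a simple graph with a 2-factor
consisting of `m` circuits. -/
structure IsClosing (P : Piece X s m) : Prop extends P.IsValid where
  chain : ∀ i, ((P.circ i).map P.base).IsChain fun x y => x = y ∨ (∃ e, P.step x e = .vert y) ∨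
    ∃ j, (x = P.right j ∧ y = P.left j) ∨ (x = P.left j ∧ y = P.right j)
  no_vert_fwd : ∀ x e e' j, P.step x e = .fwd j → P.step x e' ≠ .vert (P.left j)
  no_vert_back : ∀ x e e' j, P.step x e = .back j → P.step x e' ≠ .vert (P.right j)

end Piece

section Glue

variable {L B : Type*} [DecidableEq L] [DecidableEq B] {s m : ℕ} (k : ℕ) (P : Piece L s s)
  (Q : Piece B s m)

/-- In the cyclic arrangement of `k` copies of `P`, numbered from `0`, followed by `Q`, the left
port `j` of the piece number `i`. -/
def lport (i : ℕ) (j : Fin s) : (Fin k × L) ⊕ B :=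
  if h : i < k then .inl (⟨i, h⟩, P.left j) else .inr (Q.left j)

/-- In the cyclic arrangement of `k` copies of `P`, numbered from `0`, followed by `Q`, the right
port `j` of the piece before the piece number `i`. -/
def rport : ℕ → Fin s → (Fin k × L) ⊕ B
  | 0, j => .inr (Q.right j)
  | i + 1, j => if h : i < k then .inl (⟨i, h⟩, P.right j) else .inr (Q.right j)

/-- The neighbours of a vertex in the 2-factor glued from `k` copies of `P`, followed by `Q`. -/
def glueNbr : (Fin k × L) ⊕ B → Bool → (Fin k × L) ⊕ B
  | .inl (i, l), e => match P.step l e with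
    | .vert l' => .inl (i, l')
    | .fwd j => lport k P Q (i + 1) j
    | .back j => rport k P Q i j
  | .inr b, e => match Q.step b e with
    | .vert b' => .inr b'
    | .fwd j => lport k P Q 0 j
    | .back j => rport k P Q k j

variable {k P Q}

theorem exists_glueNbr_lport (hP : P.IsValid) (hQ : Q.IsValid) {i : ℕ} (hi : i ≤ k) (j : Fin s) :
    ∃ e, glueNbr k P Q (lport k P Q i j) e = rport k P Q i j := by
  rcases hi.lt_or_eq with h | rfl
  · obtain ⟨e, he⟩ := hP.exists_back j
    exact ⟨e, by simp [lport, h, glueNbr, he]⟩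
  · obtain ⟨e, he⟩ := hQ.exists_back j
    exact ⟨e, by simp [lport, glueNbr, he]⟩

theorem exists_glueNbr_rport (hP : P.IsValid) (hQ : Q.IsValid) {i : ℕ} (hi : i ≤ k) (j : Fin s) :
    ∃ e, glueNbr k P Q (rport k P Q i j) e = lport k P Q i j := by
  cases i with
  | zero =>
    obtain ⟨e, he⟩ := hQ.exists_fwd j
    exact ⟨e, by simp [rport, glueNbr, he]⟩
  | succ i =>
    obtain ⟨e, he⟩ := hP.exists_fwd j
    exact ⟨e, by simp [rport, Nat.lt_of_succ_le hi, glueNbr, he]⟩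

/-- Every edge of the glued 2-factor lies inside a copy of `P`, inside `Q`, or joins a right port
to the next left port. -/
theorem glueNbr_induction (hP : P.IsValid) (hQ : Q.IsValid)
    {motive : (Fin k × L) ⊕ B → (Fin k × L) ⊕ B → Prop}
    (inl : ∀ i l e l', P.step l e = .vert l' → motive (.inl (i, l)) (.inl (i, l')))
    (inr : ∀ b e b', Q.step b e = .vert b' → motive (.inr b) (.inr b'))
    (fwd : ∀ i ≤ k, ∀ j, motive (rport k P Q i j) (lport k P Q i j))
    (back : ∀ i ≤ k, ∀ j, motive (lport k P Q i j) (rport k P Q i j)) (a e) :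
    motive a (glueNbr k P Q a e) := by
  rcases a with ⟨i, l⟩ | b
  · rcases h : P.step l e with l' | j | j
    · simpa [glueNbr, h] using inl i l e l' h
    · obtain rfl := hP.eq_right _ _ _ h
      simpa [glueNbr, h, rport] using fwd (i + 1) i.2 j
    · obtain rfl := hP.eq_left _ _ _ h
      simpa [glueNbr, h, lport] using back i i.2.le j
  · rcases h : Q.step b e with b' | j | j
    · simpa [glueNbr, h] using inr b e b' h
    · obtain rfl := hQ.eq_right _ _ _ h
      simpa [glueNbr, h, rport] using fwd 0 (Nat.zero_le _) j
    · obtain rfl := hQ.eq_left _ _ _ h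
      simpa [glueNbr, h, lport] using back k le_rfl j

theorem glueNbr_symm (hP : P.IsValid) (hQ : Q.IsValid) (a e) :
    ∃ e', glueNbr k P Q (glueNbr k P Q a e) e' = a := by
  refine glueNbr_induction (motive := fun a b => ∃ e', glueNbr k P Q b e' = a) hP hQ ?_ ?_
    (fun i hi j => exists_glueNbr_lport hP hQ hi j)
    (fun i hi j => exists_glueNbr_rport hP hQ hi j) a e
  · intro i l e l' h
    obtain ⟨e', he'⟩ := hP.symm _ _ _ h
    exact ⟨e', by simp [glueNbr, he']⟩
  · intro b e b' h
    obtain ⟨e', he'⟩ := hQ.symm _ _ _ h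
    exact ⟨e', by simp [glueNbr, he']⟩

theorem glueNbr_ne (hP : P.IsValid) (hQ : Q.IsClosing) (a) :
    glueNbr k P Q a true ≠ glueNbr k P Q a false := by
  -- One of the two neighbours lies in the same piece as `a`; the other one is compared with it.
  suffices H : ∀ e, glueNbr k P Q a e ≠ glueNbr k P Q a (!e) from H true
  suffices H : ∃ e, glueNbr k P Q a e ≠ glueNbr k P Q a (!e) by
    obtain ⟨e, he⟩ := H
    intro e'
    rcases Bool.eq_or_eq_not e' e with rfl | rfl
    · exact he
    · simpa using he.symm
  rcases a with ⟨i, l⟩ | b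
  · obtain ⟨e, l', h⟩ := hP.exists_vert l
    refine ⟨e, ?_⟩
    have hne : P.step l e ≠ P.step l (!e) := by
      cases e
      · exact (hP.step_ne l).symm
      · exact hP.step_ne l
    rcases h' : P.step l (!e) with l'' | j | j
    · rw [h, h'] at hne
      simpa [glueNbr, h, h'] using hne
    · by_cases hi : (i : ℕ) + 1 < k
      · simp [glueNbr, h, h', lport, hi, Fin.ext_iff]
      · simp [glueNbr, h, h', lport, hi]
    · obtain ⟨i, hi⟩ := i
      cases i with
      | zero => simp [glueNbr, h, h', rport]
      | succ i => simp [glueNbr, h, h', rport, Nat.lt_of_succ_lt hi]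
  · obtain ⟨e, b', h⟩ := hQ.exists_vert b
    refine ⟨e, ?_⟩
    have hne : Q.step b e ≠ Q.step b (!e) := by
      cases e
      · exact (hQ.step_ne b).symm
      · exact hQ.step_ne b
    rcases h' : Q.step b (!e) with b'' | j | j
    · rw [h, h'] at hne
      simpa [glueNbr, h, h'] using hne
    · have := hQ.no_vert_fwd b (!e) e j h'
      rw [h] at this
      by_cases hk : 0 < k
      · simp [glueNbr, h, h', lport, hk]
      · simpa [glueNbr, h, h', lport, hk] using this
    · have := hQ.no_vert_back b (!e) e j h'
      rw [h] at this
      cases k with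
      | zero => simpa [glueNbr, h, h', rport] using this
      | succ k => simp [glueNbr, h, h', rport]

/-- Strands do not change the number of circuits: inserting any number `k` of copies of the piece
`P`, which consists of strands, between the right and the left ports of `Q` turns the `m` circuits
of `Q` into a 2-factor with `m` circuits. -/
theorem hasTwoFactorWith_of_glue (hP : P.IsStrands) (hQ : Q.IsClosing)
    {G : SimpleGraph ((Fin k × L) ⊕ B)}
    (hGP : ∀ i l e l', P.step l e = .vert l' → G.Adj (.inl (i, l)) (.inl (i, l')))
    (hGQ : ∀ b e b', Q.step b e = .vert b' → G.Adj (.inr b) (.inr b'))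
    (hG : ∀ i ≤ k, ∀ j, G.Adj (rport k P Q i j) (lport k P Q i j)) : HasTwoFactorWith G m := by
  have hsymm := glueNbr_symm (k := k) hP.toIsValid hQ.toIsValid
  have hadj : ∀ a e, G.Adj a (glueNbr k P Q a e) := glueNbr_induction hP.toIsValid hQ.toIsValid
    hGP hGQ hG fun i hi j => (hG i hi j).symm
  refine ⟨nbrGraph (glueNbr k P Q),
    isTwoFactor_nbrGraph hsymm (glueNbr_ne hP.toIsValid hQ) hadj, ?_⟩
  set F := nbrGraph (glueNbr k P Q)
  have hF : ∀ {a b}, F.Adj a b ↔ ∃ e, glueNbr k P Q a e = b :=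
    nbrGraph_adj hsymm fun a e => (hadj a e).ne'
  choose cP hcP using hP.cover
  choose cQ hcQ using hQ.cover
  have hcP' : ∀ l j, Step.vert l ∈ P.circ j → cP l = j := fun l j h => hP.disjoint _ _ _ (hcP l) h
  have hcQ' : ∀ b i, Step.vert b ∈ Q.circ i → cQ b = i := fun b i h => hQ.disjoint _ _ _ (hcQ b) h
  -- A strand carries the label of the vertex of `Q` at its end.
  let lab : (Fin k × L) ⊕ B → Fin m := Sum.elim (fun x => cQ (Q.left (cP x.2))) cQ
  have hleft : ∀ j, cP (P.left j) = j := fun j => hcP' _ _ (hP.left_mem j)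
  have hright : ∀ j, cP (P.right j) = j := fun j =>
    (hcP' _ _ (hP.strand _ j (hcP _))).symm.trans (hleft j)
  have hlabl : ∀ i j, lab (lport k P Q i j) = cQ (Q.left j) := by
    intro i j
    by_cases h : i < k <;> simp [lab, lport, h, hleft]
  have hlabr : ∀ i j, lab (rport k P Q i j) = cQ (Q.left j) := by
    have h0 : ∀ j, cQ (Q.right j) = cQ (Q.left j) := fun j =>
      (hcQ' _ _ (hQ.strand _ j (hcQ _))).symm
    intro i j
    cases i with
    | zero => simp [lab, rport, h0]
    | succ i => by_cases h : i < k <;> simp [lab, rport, h, hright, h0]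
  have hlink : ∀ i ≤ k, ∀ j, F.Reachable (rport k P Q i j) (lport k P Q i j) := fun i hi j =>
    (hF.2 (exists_glueNbr_rport hP.toIsValid hQ.toIsValid hi j)).reachable
  -- Within a copy of `P`, every vertex is joined to all others of its strand.
  have hPreach : ∀ (i : Fin k) l l', cP l = cP l' → F.Reachable (.inl (i, l)) (.inl (i, l')) := by
    intro i l l' h
    have hch : (((P.circ (cP l)).map P.base).map
        fun l => (Sum.inl (i, l) : (Fin k × L) ⊕ B)).IsChain F.Reachable := by
      rw [List.isChain_map]
      refine (hP.chain (cP l)).imp fun x y hxy => ?_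
      rcases hxy with rfl | ⟨e, he⟩
      · exact .refl _
      · exact (hF.2 ⟨e, by simp [glueNbr, he]⟩).reachable
    refine reachable_of_isChain hch (List.mem_map_of_mem (List.mem_map.2 ⟨_, hcP l, rfl⟩))
      (List.mem_map_of_mem (List.mem_map.2 ⟨_, h ▸ hcP l', rfl⟩))
  have hlports : ∀ n i j, i + n = k → F.Reachable (lport k P Q i j) (.inr (Q.left j)) := by
    intro n
    induction n with
    | zero =>
      intro i j h
      have : ¬ i < k := by omega
      simp [lport, this]
    | succ n ih =>
      intro i j h
      have hi : i < k := by omega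
      refine .trans ?_ (ih (i + 1) j (by omega))
      refine .trans ?_ (hlink (i + 1) hi j)
      simpa [lport, rport, hi] using hPreach ⟨i, hi⟩ _ _ ((hleft j).trans (hright j).symm)
  have hcross : ∀ j, F.Reachable (.inr (Q.right j)) (.inr (Q.left j)) := fun j =>
    (hlink 0 (Nat.zero_le _) j).trans (hlports k 0 j (Nat.zero_add k))
  have hQreach : ∀ b b', cQ b = cQ b' → F.Reachable (.inr b) (.inr b') := by
    intro b b' h
    have hch : (((Q.circ (cQ b)).map Q.base).map fun b => (Sum.inr b : (Fin k × L) ⊕ B)).IsChain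
        F.Reachable := by
      rw [List.isChain_map]
      refine (hQ.chain (cQ b)).imp fun x y hxy => ?_
      rcases hxy with rfl | ⟨e, he⟩ | ⟨j, ⟨rfl, rfl⟩ | ⟨rfl, rfl⟩⟩
      · exact .refl _
      · exact (hF.2 ⟨e, by simp [glueNbr, he]⟩).reachable
      · exact hcross j
      · exact (hcross j).symm
    refine reachable_of_isChain hch (List.mem_map_of_mem (List.mem_map.2 ⟨_, hcQ b, rfl⟩))
      (List.mem_map_of_mem (List.mem_map.2 ⟨_, h ▸ hcQ b', rfl⟩))
  have hend : ∀ a, ∃ b, lab a = cQ b ∧ F.Reachable a (.inr b) := by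
    rintro (⟨i, l⟩ | b)
    · refine ⟨Q.left (cP l), rfl, .trans ?_ (hlports (k - i) i (cP l) (by omega))⟩
      simpa [lport] using hPreach i l (P.left (cP l)) (hleft _).symm
    · exact ⟨b, rfl, .refl _⟩
  have := numCircuits_eq_card (F := F) lab ?_ ?_ ?_
  · simpa using this
  · intro a b hab
    obtain ⟨e, rfl⟩ := hF.1 hab
    refine glueNbr_induction (motive := fun a b => lab a = lab b) hP.toIsValid hQ.toIsValid ?_ ?_
      (fun i _ j => (hlabr i j).trans (hlabl i j).symm)
      (fun i _ j => (hlabl i j).trans (hlabr i j).symm) a e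
    · intro i l e l' h
      simp [lab, hcP' _ _ (hP.same _ _ _ h _ (hcP l))]
    · intro b e b' h
      simp [lab, hcQ' _ _ (hQ.same _ _ _ h _ (hcQ b))]
  · intro i
    obtain ⟨b, hb⟩ := hQ.nonempty i
    exact ⟨.inr b, hcQ' b i hb⟩
  · intro a a' h
    obtain ⟨b, hb, hab⟩ := hend a
    obtain ⟨b', hb', hab'⟩ := hend a'
    exact (hab.trans (hQreach b b' (by rw [← hb, ← hb', h]))).trans hab'.symm

end Glue

/-! ### Circuit lists and sequences of segments -/

/-- A run of consecutive vertices of a circuit. -/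
def verts {X : Type*} {s : ℕ} (l : List X) : List (Step X s) :=
  l.map .vert

theorem Piece.isStrands_fin_zero (P : Piece Empty 0 0) : P.IsStrands := by
  constructor
  on_goal 1 => constructor
  all_goals first | exact fun x : Empty => x.elim | exact fun x => x.elim0

/-- A simple finite graph has a 2-factor given by an explicit list of circuits. -/
theorem hasTwoFactorWith_of_circuits {B : Type*} [DecidableEq B] {m : ℕ} {Q : Piece B 0 m}
    (hQ : Q.IsClosing) {G : SimpleGraph B}
    (hG : ∀ b e b', Q.step b e = .vert b' → G.Adj b b') : HasTwoFactorWith G m := by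
  let f : (Fin 0 × Empty) ⊕ B ≃ B := Equiv.emptySum _ _
  refine .of_iso (SimpleGraph.Iso.comap f G).symm
    (hasTwoFactorWith_of_glue (Piece.isStrands_fin_zero ⟨Fin.elim0, Fin.elim0, Fin.elim0⟩) hQ
      (fun i => i.elim0) (fun b e b' h => ?_) (fun _ _ j => j.elim0))
  exact hG b e b' h

section Segments

variable {L W : Type*}

/-- A sequence of `k` segments followed by a sequence of `c` segments. -/
def segEquiv (k c : ℕ) (L : Type*) : (Fin k × L) ⊕ (Fin c × L) ≃ Fin (k + c) × L :=
  (Equiv.sumProdDistrib _ _ _).symm.trans (Equiv.prodCongr finSumFinEquiv (Equiv.refl _))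

@[simp]
theorem segEquiv_inl (k c : ℕ) (i : Fin k) (l : L) :
    segEquiv k c L (.inl (i, l)) = (i.castAdd c, l) := rfl

@[simp]
theorem segEquiv_inr (k c : ℕ) (i : Fin c) (l : L) :
    segEquiv k c L (.inr (i, l)) = (i.natAdd k, l) := rfl

/-- A sequence of `k` segments followed by a sequence of `c` segments and some further vertices. -/
def segEquivW (k c : ℕ) (L W : Type*) :
    (Fin k × L) ⊕ ((Fin c × L) ⊕ W) ≃ (Fin (k + c) × L) ⊕ W :=
  (Equiv.sumAssoc _ _ _).symm.trans (Equiv.sumCongr (segEquiv k c L) (Equiv.refl _))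

@[simp]
theorem segEquivW_inl (k c : ℕ) (i : Fin k) (l : L) :
    segEquivW k c L W (.inl (i, l)) = .inl (i.castAdd c, l) := rfl

@[simp]
theorem segEquivW_inr_inl (k c : ℕ) (i : Fin c) (l : L) :
    segEquivW k c L W (.inr (.inl (i, l))) = .inl (i.natAdd k, l) := rfl

@[simp]
theorem segEquivW_inr_inr (k c : ℕ) (w : W) :
    segEquivW k c L W (.inr (.inr w)) = .inr w := rfl

end Segments

/-! ### The graphs `T_k(n)` -/

/-- A segment of `T(n)` traversed by two paths, which use only the ports with superscripts `1`
and `2`. -/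
def tStrands : Piece TLabel 2 2 where
  left := ![.u1, .u2]
  right := ![.v1, .v2]
  circ := ![
    verts [.u1, .w1, .x1, .t1, .x3, .y3, .z2, .y1, .z1, .v1] ++ [.fwd 0],
    verts [.u2, .w3, .u3, .w2, .x2, .y2, .z3, .v3, .t2, .v2] ++ [.fwd 1]]

theorem tStrands_isStrands : tStrands.IsStrands := by
  constructor
  on_goal 1 => constructor
  all_goals decide +kernel

/-- The piece `Q`, closed up in the way prescribed by `close`, is compatible with the strands
`tStrands`. -/
structure Piece.IsClosingT {m : ℕ} (Q : Piece (Fin 1 × TLabel) 2 m)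
    (close : TLabel → TLabel → Bool) : Prop extends Q.IsClosing where
  seg : ∀ b e b', Q.step b e = .vert b' → b.2.seg b'.2 ∨ b'.2.seg b.2
  left_eq : ∀ j, Q.left j = (0, tStrands.left j)
  close_right : ∀ j, close (Q.right j).2 (tStrands.left j)
  right_ne : ∀ j, (Q.right j).2 ≠ tStrands.left j

theorem Piece.IsClosingT.hasTwoFactorWith {m : ℕ} {Q : Piece (Fin 1 × TLabel) 2 m}
    {close : TLabel → TLabel → Bool} (hQ : Q.IsClosingT close) (k : ℕ) :
    HasTwoFactorWith (SimpleGraph.fromRel (tRel (k + 1) close)) m := by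
  have hne : ∀ a b, TLabel.seg a b ∨ TLabel.seg b a → a ≠ b := by decide
  refine .of_iso (SimpleGraph.Iso.comap (segEquiv k 1 TLabel) _).symm
    (hasTwoFactorWith_of_glue tStrands_isStrands hQ.toIsClosing ?_ ?_ ?_)
  · intro i l e l' h
    have hs : l.seg l' ∨ l'.seg l := by
      revert l e l'
      decide +kernel
    have := hne _ _ hs
    simp [SimpleGraph.fromRel_adj, tRel, this]
    tauto
  · rintro ⟨i, l⟩ e ⟨i', l'⟩ h
    have hs := hQ.seg _ _ _ h
    have := hne _ _ hs
    obtain rfl : i = i' := Subsingleton.elim _ _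
    simp [SimpleGraph.fromRel_adj, tRel, this]
    tauto
  · intro i hi j
    have hl : segEquiv k 1 TLabel (lport k tStrands Q i j) =
        (⟨i, Nat.lt_succ_of_le hi⟩, tStrands.left j) := by
      rcases hi.lt_or_eq with h | rfl
      · simp [lport, h]
      · simp [lport, hQ.left_eq]; rfl
    rw [SimpleGraph.comap_adj, hl, SimpleGraph.fromRel_adj]
    cases i with
    | zero =>
      have h₁ := hQ.close_right j
      have h₂ := hQ.right_ne j
      obtain ⟨⟨i, l⟩, hr⟩ : ∃ r, Q.right j = r := ⟨_, rfl⟩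
      obtain rfl : i = 0 := Subsingleton.elim _ _
      rw [hr] at h₁ h₂
      simp [rport, hr, tRel, h₁, h₂]
    | succ i =>
      have : TLabel.close1 (tStrands.right j) (tStrands.left j) := by
        clear hl
        revert j
        decide
      simp [rport, Nat.lt_of_succ_le hi, tRel, this]

/-! ### The graphs `D(n)` -/

/-- A segment of `C(m)` traversed by three paths. -/
def dStrands : Piece CLabel 3 3 where
  left := ![.u1, .u2, .u4]
  right := ![.v1, .u3, .v2]
  circ := ![verts [.u1, .v1] ++ [.fwd 0], verts [.u2, .u3] ++ [.fwd 1],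
    verts [.u4, .v2] ++ [.fwd 2]]

theorem dStrands_isStrands : dStrands.IsStrands := by
  constructor
  on_goal 1 => constructor
  all_goals decide +kernel

/-- The edges of `D(3m + r)` between the last `c` segments and the additional vertices, except
those that close up the graph by leading to the first segment. -/
def dEndRel (c r : ℕ) :
    (Fin c × CLabel) ⊕ Fin (2 * r) → (Fin c × CLabel) ⊕ Fin (2 * r) → Prop
  | .inl p, .inl q =>
      (p.1 = q.1 ∧ p.2.seg q.2 = true) ∨ (p.1.val + 1 = q.1.val ∧ p.2.link q.2 = true)
  | .inl p, .inr k => p.1.val + 1 = c ∧ CLabel.lastW r p.2 k.val = true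
  | .inr _, .inl _ => False
  | .inr k, .inr l => k.val + 1 = l.val

/-- The edges of `D(3m + r)` from the last `c` segments and the additional vertices to the vertices
of the first segment, the latter being given by their labels. -/
def dCloseRel (c r : ℕ) : (Fin c × CLabel) ⊕ Fin (2 * r) → CLabel → Prop
  | .inl p, l => p.1.val + 1 = c ∧ CLabel.close r p.2 l = true
  | .inr k, l => CLabel.firstW r l k.val = true

instance (c r : ℕ) : DecidableRel (dEndRel c r)
  | .inl _, .inl _ => inferInstanceAs (Decidable (_ ∨ _))
  | .inl _, .inr _ => inferInstanceAs (Decidable (_ ∧ _))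
  | .inr _, .inl _ => inferInstanceAs (Decidable False)
  | .inr _, .inr _ => inferInstanceAs (Decidable (_ = _))

instance (c r : ℕ) : DecidableRel (dCloseRel c r)
  | .inl _, _ => inferInstanceAs (Decidable (_ ∧ _))
  | .inr _, _ => inferInstanceAs (Decidable (_ = _))

/-- The piece `Q`, consisting of the last segments of `D(3m + r)` and its additional vertices, is
compatible with the strands `dStrands`. -/
structure Piece.IsClosingD {c r m : ℕ} (Q : Piece ((Fin (c + 1) × CLabel) ⊕ Fin (2 * r)) 3 m) :
    Prop extends Q.IsClosing where
  adj : ∀ b e b', Q.step b e = .vert b' → dEndRel (c + 1) r b b' ∨ dEndRel (c + 1) r b' b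
  left_eq : ∀ j, Q.left j = .inl (0, dStrands.left j)
  close_right : ∀ j, dCloseRel (c + 1) r (Q.right j) (dStrands.left j)

theorem dRel_irrefl {m r : ℕ} (hr : r < 3) (a) : ¬ dRel m r a a := by
  have hseg : ∀ l, ¬ CLabel.seg l l := by decide
  have hclose : ∀ r < 3, ∀ l, ¬ CLabel.close r l l := by decide
  rcases a with ⟨i, l⟩ | k
  · simp [dRel, hseg, hclose r hr]
  · simp [dRel]

theorem dRel_of_dEndRel {k c r : ℕ} {a b} (h : dEndRel c r a b) :
    dRel (k + c) r (segEquivW k c CLabel _ (.inr a)) (segEquivW k c CLabel _ (.inr b)) := by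
  rcases a with ⟨i, l⟩ | w <;> rcases b with ⟨i', l'⟩ | w' <;> simp [dEndRel, dRel] at h ⊢
  · rcases h with ⟨rfl, h⟩ | ⟨hi, h⟩
    · exact .inl ⟨rfl, h⟩
    · exact .inr (.inl ⟨by omega, h⟩)
  · exact .inr ⟨by omega, h.2⟩
  · exact h

theorem Piece.IsClosingD.hasTwoFactorWith {c r m : ℕ} (hr : r < 3)
    {Q : Piece ((Fin (c + 1) × CLabel) ⊕ Fin (2 * r)) 3 m} (hQ : Q.IsClosingD) (k : ℕ) :
    HasTwoFactorWith (SimpleGraph.fromRel (dRel (k + (c + 1)) r)) m := by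
  have hirr := fun a => dRel_irrefl (m := k + (c + 1)) hr a
  have hadj : ∀ a b, dRel (k + (c + 1)) r a b ∨ dRel (k + (c + 1)) r b a →
      (SimpleGraph.fromRel (dRel (k + (c + 1)) r)).Adj a b := by
    intro a b h
    refine (SimpleGraph.fromRel_adj _ _ _).2 ⟨?_, h⟩
    rintro rfl
    exact hirr a (h.elim id id)
  refine .of_iso (SimpleGraph.Iso.comap (segEquivW k (c + 1) CLabel _) _).symm
    (hasTwoFactorWith_of_glue dStrands_isStrands hQ.toIsClosing ?_ ?_ ?_)
  · intro i l e l' h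
    have hs : l.seg l' ∨ l'.seg l := by
      revert l e l'
      decide +kernel
    exact hadj _ _ (hs.imp (fun hs => .inl ⟨rfl, hs⟩) (fun hs => .inl ⟨rfl, hs⟩))
  · intro b e b' h
    exact hadj _ _ ((hQ.adj b e b' h).imp dRel_of_dEndRel dRel_of_dEndRel)
  · intro i hi j
    have hl : segEquivW k (c + 1) CLabel _ (lport k dStrands Q i j) =
        .inl (⟨i, by omega⟩, dStrands.left j) := by
      rcases hi.lt_or_eq with h | rfl
      · simp [lport, h]
      · simp [lport, hQ.left_eq]; rfl
    rw [SimpleGraph.comap_adj, hl]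
    cases i with
    | zero =>
      have h := hQ.close_right j
      rw [rport]
      rcases hb : Q.right j with ⟨i, l⟩ | w <;> rw [hb] at h
      · exact hadj _ _ (.inl (.inr (.inr ⟨by simpa [add_assoc] using h.1, rfl, h.2⟩)))
      · exact hadj _ _ (.inr (.inl ⟨rfl, h⟩))
    | succ i =>
      have : CLabel.link (dStrands.right j) (dStrands.left j) := by
        clear hl
        revert j
        decide
      rw [rport, dif_pos (Nat.lt_of_succ_le hi)]
      exact hadj _ _ (.inl (.inr (.inl ⟨rfl, this⟩)))

/-! ### The closing pieces -/

section ClosingPieces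

set_option synthInstance.maxSize 1000

/-- A run of consecutive vertices of a circuit in a single segment `G_T`. -/
def tVerts {s : ℕ} (l : List TLabel) : List (Step (Fin 1 × TLabel) s) :=
  verts (l.map (0, ·))

/-- The last two segments of `D(3m)`, with one circuit. -/
def dHam0 : Piece ((Fin 2 × CLabel) ⊕ Fin (2 * 0)) 3 1 where
  left j := .inl (0, dStrands.left j)
  right := ![.inl (1, .v1), .inl (1, .u3), .inl (1, .v2)]
  circ := ![
    verts [.inl (0, .u1), .inl (0, .u2)] ++ [.back 1] ++
    verts [.inl (1, .u3), .inl (1, .u2), .inl (0, .u3), .inl (0, .u4)] ++ [.back 2] ++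
    verts [.inl (1, .v2), .inl (1, .u4), .inl (0, .v2), .inl (0, .v1), .inl (1, .u1),
      .inl (1, .v1)] ++ [.fwd 0]]

theorem dHam0_isClosingD : dHam0.IsClosingD := by
  constructor
  on_goal 1 => constructor
  on_goal 1 => constructor
  all_goals decide +kernel

/-- The last segment and the additional vertices of `D(3m + 1)`, with one circuit. -/
def dHam1 : Piece ((Fin 1 × CLabel) ⊕ Fin (2 * 1)) 3 1 where
  left j := .inl (0, dStrands.left j)
  right := ![.inr 0, .inl (0, .v2), .inr 1]
  circ := ![
    verts [.inr 0, .inr 1] ++ [.fwd 2] ++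
    verts [.inl (0, .u4), .inl (0, .u3), .inl (0, .u2)] ++ [.back 1] ++
    verts [.inl (0, .v2), .inl (0, .v1), .inl (0, .u1)] ++ [.back 0]]

theorem dHam1_isClosingD : dHam1.IsClosingD := by
  constructor
  on_goal 1 => constructor
  on_goal 1 => constructor
  all_goals decide +kernel

/-- The last segment and the additional vertices of `D(3m + 2)`, with one circuit. -/
def dHam2 : Piece ((Fin 1 × CLabel) ⊕ Fin (2 * 2)) 3 1 where
  left j := .inl (0, dStrands.left j)
  right := ![.inr 3, .inr 0, .inr 2]
  circ := ![
    verts [.inl (0, .u2), .inl (0, .u3), .inr 1, .inr 2] ++ [.fwd 2] ++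
    verts [.inl (0, .u4), .inl (0, .v2), .inr 3] ++ [.fwd 0] ++
    verts [.inl (0, .u1), .inl (0, .v1), .inr 0] ++ [.fwd 1]]

theorem dHam2_isClosingD : dHam2.IsClosingD := by
  constructor
  on_goal 1 => constructor
  on_goal 1 => constructor
  all_goals decide +kernel

/-- The last three segments of `D(3m)`, with two circuits. -/
def dTwo0 : Piece ((Fin 3 × CLabel) ⊕ Fin (2 * 0)) 3 2 where
  left j := .inl (0, dStrands.left j)
  right := ![.inl (2, .v1), .inl (2, .u3), .inl (2, .v2)]
  circ := ![
    verts [.inl (0, .u1), .inl (0, .u2)] ++ [.back 1] ++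
    verts [.inl (2, .u3), .inl (2, .u2), .inl (2, .u1), .inl (2, .v1)] ++ [.fwd 0],
    verts [.inl (2, .v2), .inl (2, .u4), .inl (1, .v2), .inl (1, .v1), .inl (1, .u1),
      .inl (0, .v1), .inl (0, .v2), .inl (1, .u4), .inl (1, .u3), .inl (1, .u2),
      .inl (0, .u3), .inl (0, .u4)] ++ [.back 2]]

theorem dTwo0_isClosingD : dTwo0.IsClosingD := by
  constructor
  on_goal 1 => constructor
  on_goal 1 => constructor
  all_goals decide +kernel

/-- The last four segments and the additional vertices of `D(3m + 1)`, with two circuits. With fewer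
segments, no 2-factor with two circuits contains all three closing edges. -/
def dTwo1 : Piece ((Fin 4 × CLabel) ⊕ Fin (2 * 1)) 3 2 where
  left j := .inl (0, dStrands.left j)
  right := ![.inr 0, .inl (3, .v2), .inr 1]
  circ := ![
    verts [.inl (3, .u2), .inl (2, .u3), .inl (2, .u4), .inl (2, .v2), .inl (3, .u4),
      .inl (3, .u3)],
    verts [.inr 0, .inr 1] ++ [.fwd 2] ++
    verts [.inl (0, .u4), .inl (0, .u3), .inl (0, .u2)] ++ [.back 1] ++
    verts [.inl (3, .v2), .inl (3, .v1), .inl (3, .u1), .inl (2, .v1), .inl (2, .u1),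
      .inl (2, .u2), .inl (1, .u3), .inl (1, .u2), .inl (1, .u1), .inl (1, .v1),
      .inl (1, .v2), .inl (1, .u4), .inl (0, .v2), .inl (0, .v1), .inl (0, .u1)] ++ [.back
      0]]

theorem dTwo1_isClosingD : dTwo1.IsClosingD := by
  constructor
  on_goal 1 => constructor
  on_goal 1 => constructor
  all_goals decide +kernel

/-- The last segment and the additional vertices of `D(3m + 2)`, with two circuits. -/
def dTwo2 : Piece ((Fin 1 × CLabel) ⊕ Fin (2 * 2)) 3 2 where
  left j := .inl (0, dStrands.left j)
  right := ![.inr 3, .inr 0, .inr 2]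
  circ := ![
    verts [.inl (0, .u1), .inl (0, .v1), .inl (0, .v2), .inr 3] ++ [.fwd 0],
    verts [.inr 0, .inr 1, .inr 2] ++ [.fwd 2] ++
    verts [.inl (0, .u4), .inl (0, .u3), .inl (0, .u2)] ++ [.back 1]]

theorem dTwo2_isClosingD : dTwo2.IsClosingD := by
  constructor
  on_goal 1 => constructor
  on_goal 1 => constructor
  all_goals decide +kernel

/-- The whole graph `D(10)`, which is too short for `dTwo1`, with two circuits. -/
def dTwo10 : Piece ((Fin 3 × CLabel) ⊕ Fin (2 * 1)) 0 2 where
  left := ![]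
  right := ![]
  circ := ![
    verts [.inl (0, .u1), .inr 0, .inr 1, .inl (0, .u4), .inl (0, .u3), .inl (0, .u2)],
    verts [.inl (1, .u1), .inl (0, .v1), .inl (0, .v2), .inl (1, .u4), .inl (1, .v2),
      .inl (1, .v1), .inl (2, .u1), .inl (2, .v1), .inl (2, .v2), .inl (2, .u4),
      .inl (2, .u3), .inl (2, .u2), .inl (1, .u3), .inl (1, .u2)]]

theorem dTwo10_isClosing : dTwo10.IsClosing := by
  constructor
  on_goal 1 => constructor
  all_goals decide +kernel

/-- The last segment of `T_1(n)`, with one circuit. -/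
def t1Ham : Piece (Fin 1 × TLabel) 2 1 where
  left j := (0, tStrands.left j)
  right := ![(0, .v1), (0, .v2)]
  circ := ![
    tVerts [.u1, .w1, .u2] ++ [.back 1] ++
    tVerts [.v2, .z2, .y3, .x3, .w3, .u3, .w2, .x2, .t1, .x1, .y1, .z1, .y2, .z3, .v3, .t2,
      .v1] ++ [.fwd 0]]

theorem t1Ham_isClosingT : t1Ham.IsClosingT TLabel.close1 := by
  constructor
  on_goal 1 => constructor
  on_goal 1 => constructor
  all_goals decide +kernel

/-- The last segment of `T_1(n)`, with two circuits. -/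
def t1Two : Piece (Fin 1 × TLabel) 2 2 where
  left j := (0, tStrands.left j)
  right := ![(0, .v1), (0, .v2)]
  circ := ![
    tVerts [.v1, .t2, .v3, .z3, .y3, .x3, .t1, .x1, .w1, .u1] ++ [.back 0],
    tVerts [.v2, .z2, .y1, .z1, .y2, .x2, .w2, .u3, .w3, .u2] ++ [.back 1]]

theorem t1Two_isClosingT : t1Two.IsClosingT TLabel.close1 := by
  constructor
  on_goal 1 => constructor
  on_goal 1 => constructor
  all_goals decide +kernel

/-- The last segment of `T_2(n)`, with one circuit. -/
def t2Ham : Piece (Fin 1 × TLabel) 2 1 where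
  left j := (0, tStrands.left j)
  right := ![(0, .v3), (0, .v2)]
  circ := ![
    tVerts [.v3, .t2, .v1, .z1, .y1, .z2, .v2] ++ [.fwd 1] ++
    tVerts [.u2, .w3, .u3, .w2, .x2, .y2, .z3, .y3, .x3, .t1, .x1, .w1, .u1] ++ [.back 0]]

theorem t2Ham_isClosingT : t2Ham.IsClosingT TLabel.close2 := by
  constructor
  on_goal 1 => constructor
  on_goal 1 => constructor
  all_goals decide +kernel

/-- The last segment of `T_2(n)`, with two circuits. -/
def t2Two : Piece (Fin 1 × TLabel) 2 2 where
  left j := (0, tStrands.left j)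
  right := ![(0, .v3), (0, .v2)]
  circ := ![
    tVerts [.x2, .t1, .x1, .y1, .z2, .y3, .x3, .w3, .u3, .w2],
    tVerts [.u1, .w1, .u2] ++ [.back 1] ++
    tVerts [.v2, .t2, .v1, .z1, .y2, .z3, .v3] ++ [.fwd 0]]

theorem t2Two_isClosingT : t2Two.IsClosingT TLabel.close2 := by
  constructor
  on_goal 1 => constructor
  on_goal 1 => constructor
  all_goals decide +kernel

/-- The last segment of `T_3(n)`, with one circuit. -/
def t3Ham : Piece (Fin 1 × TLabel) 2 1 where
  left j := (0, tStrands.left j)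
  right := ![(0, .v3), (0, .v1)]
  circ := ![
    tVerts [.v3, .t2, .v2, .z2, .y1, .z1, .v1] ++ [.fwd 1] ++
    tVerts [.u2, .w3, .u3, .w2, .x2, .y2, .z3, .y3, .x3, .t1, .x1, .w1, .u1] ++ [.back 0]]

theorem t3Ham_isClosingT : t3Ham.IsClosingT TLabel.close3 := by
  constructor
  on_goal 1 => constructor
  on_goal 1 => constructor
  all_goals decide +kernel

/-- The last segment of `T_3(n)`, with two circuits. -/
def t3Two : Piece (Fin 1 × TLabel) 2 2 where
  left j := (0, tStrands.left j)
  right := ![(0, .v3), (0, .v1)]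
  circ := ![
    tVerts [.v3, .z3, .y3, .x3, .t1, .x1, .w1, .u1] ++ [.back 0],
    tVerts [.u2, .w3, .u3, .w2, .x2, .y2, .z1, .y1, .z2, .v2, .t2, .v1] ++ [.fwd 1]]

theorem t3Two_isClosingT : t3Two.IsClosingT TLabel.close3 := by
  constructor
  on_goal 1 => constructor
  on_goal 1 => constructor
  all_goals decide +kernel

end ClosingPieces

/-! ### The parity of the number of circuits by a search through all perfect matchings -/

section Search

variable {V : Type*}

/-- Adjacency in the complement of a matching: `nb` lists the neighbours of every vertex, and `M`
the edges of the matching, each in one direction. -/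
def compAdj (nb : V → List V) (M : List (V × V)) (a b : V) : Prop :=
  b ∈ nb a ∧ (a, b) ∉ M ∧ (b, a) ∉ M

instance [DecidableEq V] (nb : V → List V) (M : List (V × V)) : DecidableRel (compAdj nb M) :=
  fun _ _ => inferInstanceAs (Decidable (_ ∧ _))

/-- The circuit of the complement of `M` that starts with the edge from `prev` to `cur` and ends in
the vertex `last`; the number of steps is bounded by the first argument. -/
def traceCircuit [DecidableEq V] (nb : V → List V) (M : List (V × V)) (last : V) :
    ℕ → V → V → List V
  | 0, _, _ => []
  | fuel + 1, prev, cur => cur ::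
    if cur = last then [] else
      match (nb cur).find? fun b => compAdj nb M cur b ∧ b ≠ prev with
      | none => []
      | some b => traceCircuit nb M last fuel cur b

/-- The circuits of the complement of `M` that meet the given list of vertices, each once. -/
def traceCircuits [DecidableEq V] (nb : V → List V) (M : List (V × V)) (fuel : ℕ) :
    List V → List (List V)
  | [] => []
  | a :: as =>
    let cs := traceCircuits nb M fuel as
    if ∃ c ∈ cs, a ∈ c then cs else
      match (nb a).find? fun b => compAdj nb M a b with
      | none => cs
      | some b => traceCircuit nb M a fuel a b :: cs

/-- The lists in `cs` are the vertex sets of the components of the graph with adjacency `compAdj`,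
and their number is odd. -/
def IsOddCircuitList [Fintype V] (nb : V → List V) (M : List (V × V)) (cs : List (List V)) : Prop :=
  cs.length % 2 = 1 ∧ (∀ a, ∃ c ∈ cs, a ∈ c) ∧ (cs.Pairwise fun c d => ∀ a ∈ c, a ∉ d) ∧
    ∀ c ∈ cs, c ≠ [] ∧ c.IsChain (compAdj nb M) ∧ ∀ a ∈ c, ∀ b ∈ nb a, compAdj nb M a b → b ∈ c

instance [Fintype V] [DecidableEq V] (nb : V → List V) (M : List (V × V)) (cs : List (List V)) :
    Decidable (IsOddCircuitList nb M cs) :=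
  inferInstanceAs (Decidable (_ ∧ _))

/-- Whether `leaf` holds for all extensions of the matching `M` by edges, one at each vertex of the
list, whose other ends are distinct. -/
def searchMatchings [DecidableEq V] (nb : V → List V) (leaf : List (V × V) → Bool) :
    List V → List (V × V) → Bool
  | [], M => leaf M
  | a :: as, M =>
    (nb a).all fun b => M.any (fun p => p.2 = b) || searchMatchings nb leaf as ((a, b) :: M)

theorem leaf_of_searchMatchings [DecidableEq V] {nb : V → List V} {leaf : List (V × V) → Bool}
    {μ : V → V} (hμ : Function.Injective μ) (hnb : ∀ a, μ a ∈ nb a) :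
    ∀ (as : List V) (M : List (V × V)), as.Nodup → (∀ p ∈ M, p.2 = μ p.1 ∧ p.1 ∉ as) →
      searchMatchings nb leaf as M = true → leaf ((as.map fun a => (a, μ a)).reverse ++ M) = true
  | [], M, _, _, h => h
  | a :: as, M, has, hM, h => by
    rw [List.nodup_cons] at has
    have h' := List.all_eq_true.1 h _ (hnb a)
    rw [Bool.or_eq_true, List.any_eq_true] at h'
    rcases h' with ⟨p, hp, hpa⟩ | h'
    · obtain ⟨h₁, h₂⟩ := hM p hp
      rw [decide_eq_true_eq, h₁] at hpa
      exact absurd (by simp [hμ hpa]) h₂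
    · have := leaf_of_searchMatchings hμ hnb as ((a, μ a) :: M) has.2 ?_ h'
      · simpa using this
      · intro p hp
        rcases List.mem_cons.1 hp with rfl | hp
        · exact ⟨rfl, has.1⟩
        · exact ⟨(hM p hp).1, fun h => (hM p hp).2 (List.mem_cons_of_mem _ h)⟩

/-- In a cubic graph, the edges outside a 2-factor form a perfect matching. -/
theorem IsTwoFactor.exists_matching {G F : SimpleGraph V} (hF : IsTwoFactor G F)
    (hG : ∀ v, (G.neighborSet v).ncard = 3) :
    ∃ μ : V → V, Function.Involutive μ ∧ (∀ a, G.Adj a (μ a)) ∧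
      ∀ a b, F.Adj a b ↔ G.Adj a b ∧ b ≠ μ a := by
  have h : ∀ a, ∃ b, G.neighborSet a \ F.neighborSet a = {b} := fun a => by
    have hsub : F.neighborSet a ⊆ G.neighborSet a := fun b hb => hF.1 hb
    rw [← Set.ncard_eq_one, Set.ncard_sdiff hsub
      (Set.finite_of_ncard_ne_zero (by rw [hF.2]; decide)), hG, hF.2]
  choose μ hμ using h
  have hμ' : ∀ a b, (G.Adj a b ∧ ¬ F.Adj a b) ↔ b = μ a := fun a b => by
    simpa using Set.ext_iff.1 (hμ a) b
  have hadj : ∀ a, G.Adj a (μ a) ∧ ¬ F.Adj a (μ a) := fun a => (hμ' a _).2 rfl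
  refine ⟨μ, fun a => ((hμ' (μ a) a).1 ⟨(hadj a).1.symm, fun h => (hadj a).2 h.symm⟩).symm,
    fun a => (hadj a).1, fun a b => ⟨fun h => ⟨hF.1 h, ?_⟩, fun ⟨h, hb⟩ => ?_⟩⟩
  · rintro rfl
    exact (hadj a).2 h
  · by_contra hF
    exact hb ((hμ' a b).1 ⟨h, hF⟩)

theorem numCircuits_odd_of_isOddCircuitList [Fintype V] {F : SimpleGraph V} {nb : V → List V}
    {M : List (V × V)} (hF : ∀ a b, F.Adj a b ↔ compAdj nb M a b) {cs : List (List V)}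
    (h : IsOddCircuitList nb M cs) : numCircuits F % 2 = 1 := by
  obtain ⟨hodd, hcov, hdis, hc⟩ := h
  have hlab : ∀ a, ∃ i : Fin cs.length, a ∈ cs[i] := fun a => by
    obtain ⟨c, hc, ha⟩ := hcov a
    obtain ⟨i, hi, rfl⟩ := List.getElem_of_mem hc
    exact ⟨⟨i, hi⟩, ha⟩
  choose lab hlab using hlab
  have huniq : ∀ a (i : Fin cs.length), a ∈ cs[i] → lab a = i := by
    intro a i ha
    rw [List.pairwise_iff_getElem] at hdis
    rcases lt_trichotomy (lab a) i with h | h | h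
    · exact absurd ha (hdis _ _ _ _ h a (hlab a))
    · exact h
    · exact absurd (hlab a) (hdis _ _ _ _ h a ha)
  rw [numCircuits_eq_card (F := F) lab, Fintype.card_fin, hodd]
  · intro a b hab
    have := (hF a b).1 hab
    exact (huniq b _ ((hc _ (List.getElem_mem _)).2.2 a (hlab a) b this.1 this)).symm
  · intro i
    obtain ⟨a, ha⟩ := List.exists_mem_of_ne_nil _ (hc cs[i] (List.getElem_mem _)).1
    exact ⟨a, huniq a i ha⟩
  · intro a b hab
    refine reachable_of_isChain (l := cs[lab a]) ?_ (hlab a) (hab ▸ hlab b)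
    exact (hc _ (List.getElem_mem _)).2.1.imp fun x y hxy => ((hF x y).2 hxy).reachable

/-- The number of circuits of every 2-factor of a cubic graph is odd if a search through its perfect
matchings confirms this. The list `as` contains at least one end of every edge. -/
theorem numCircuits_odd_of_search [Fintype V] [DecidableEq V] {G : SimpleGraph V} {nb : V → List V}
    (hnb : ∀ a b, G.Adj a b ↔ b ∈ nb a) (hnodup : ∀ a, (nb a).Nodup ∧ (nb a).length = 3)
    {as : List V} (has : as.Nodup) (hcover : ∀ a, ∀ b ∈ nb a, a ∈ as ∨ b ∈ as)
    (hsearch : searchMatchings nb (fun M => IsOddCircuitList nb M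
      (traceCircuits nb M (Fintype.card V) as)) as [] = true)
    {F : SimpleGraph V} (hF : IsTwoFactor G F) : numCircuits F % 2 = 1 := by
  obtain ⟨μ, hμ, hGμ, hadj⟩ := hF.exists_matching fun v => by
    rw [← (hnodup v).2, ← List.toFinset_card_of_nodup (hnodup v).1, ← Set.ncard_coe_finset]
    congr 1
    ext b
    simp [hnb]
  have hleaf := leaf_of_searchMatchings hμ.injective (fun a => (hnb _ _).1 (hGμ a)) as [] has
    (by simp) hsearch
  refine numCircuits_odd_of_isOddCircuitList (fun a b => ?_) (of_decide_eq_true hleaf)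
  have hmem : ∀ x y, (x, y) ∈ (as.map fun a => (a, μ a)).reverse ++ [] ↔ x ∈ as ∧ y = μ x := by
    intro x y
    simp [eq_comm]
  rw [hadj, compAdj, hmem, hmem, hnb]
  refine and_congr_right fun hb => ⟨fun h => ⟨fun h' => h h'.2, fun h' => h ?_⟩, fun h hba => ?_⟩
  · rw [h'.2, hμ]
  · rcases hcover a b hb with ha | hb
    · exact h.1 ⟨ha, hba⟩
    · exact h.2 ⟨hb, by rw [hba, hμ]⟩

end Search

/-! ### The Pappus graph and the Heawood graph -/

/-- The neighbours of the vertices of the Pappus graph. -/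
def pappusNbrs (i : ZMod 18) : List (ZMod 18) :=
  [i + 1, i - 1,
    (![13, 6, 9, 14, 11, 16, 1, 12, 15, 2, 17, 4, 7, 18, 3, 8, 5, 10] : Fin 18 → ZMod 18) i]

theorem pappusGraph_adj : ∀ a b, pappusGraph.Adj a b ↔ b ∈ pappusNbrs a := by
  intro a b
  rw [pappusGraph, SimpleGraph.fromRel_adj]
  revert a b
  decide +kernel

theorem numCircuits_pappusGraph {F : SimpleGraph (ZMod 18)} (hF : IsTwoFactor pappusGraph F) :
    numCircuits F % 2 = 1 :=
  numCircuits_odd_of_search (as := [1, 3, 5, 7, 9, 11, 13, 15, 17]) pappusGraph_adj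
    (by decide +kernel) (by decide +kernel) (by decide +kernel) (by decide +kernel) hF

-- Instance resolution finds the structural `BEq` of a sum type, which has no `LawfulBEq` instance.
instance {α β : Type*} [DecidableEq α] [DecidableEq β] (a : α ⊕ β) (l : List (α ⊕ β)) :
    Decidable (a ∈ l) :=
  @List.instDecidableMemOfLawfulBEq _ instBEqOfDecidableEq _ a l

/-- The neighbours of the vertices of the Heawood graph. -/
def heawoodNbrs : ZMod 7 ⊕ ZMod 7 → List (ZMod 7 ⊕ ZMod 7)
  | .inl p => [.inr p, .inr (p - 1), .inr (p - 3)]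
  | .inr l => [.inl l, .inl (l + 1), .inl (l + 3)]

theorem heawoodGraph_adj : ∀ a b, heawoodGraph.Adj a b ↔ b ∈ heawoodNbrs a := by
  have h : ∀ p l : ZMod 7, (p = l ∨ p = l + 1 ∨ p = l + 3 ↔ l = p ∨ l = p - 1 ∨ l = p - 3) := by
    decide
  rintro (p | l) (p' | l') <;>
    simp [heawoodGraph, leviGraph, SimpleGraph.fromRel_adj, heawoodNbrs, h]

theorem numCircuits_heawoodGraph {F : SimpleGraph (ZMod 7 ⊕ ZMod 7)}
    (hF : IsTwoFactor heawoodGraph F) : numCircuits F % 2 = 1 :=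
  numCircuits_odd_of_search (as := [0, 1, 2, 3, 4, 5, 6].map .inr) heawoodGraph_adj
    (by decide +kernel) (by decide +kernel) (by decide +kernel) (by decide +kernel) hF

/-- The Hamiltonian circuit `v_1 v_2 ... v_18` of the Pappus graph. -/
def pappusHam : Piece (ZMod 18) 0 1 where
  left := ![]
  right := ![]
  circ := ![verts [1, 2, 3, 4, 5, 6, 7, 8, 9, 10, 11, 12, 13, 14, 15, 16, 17, 18]]

theorem pappusHam_isClosing : pappusHam.IsClosing := by
  constructor
  on_goal 1 => constructor
  all_goals decide +kernel

theorem isPseudoTwoFactorIsomorphic_of_odd {V : Type*} {G : SimpleGraph V} {c : ℕ}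
    (h : HasTwoFactorWith G c) (hodd : ∀ F, IsTwoFactor G F → numCircuits F % 2 = 1) :
    IsPseudoTwoFactorIsomorphic G := by
  obtain ⟨F, hF, -⟩ := h
  exact ⟨⟨F, hF⟩, fun F₁ F₂ h₁ h₂ => (hodd F₁ h₁).trans (hodd F₂ h₂).symm⟩

theorem isPseudoTwoFactorIsomorphic_pappusGraph : IsPseudoTwoFactorIsomorphic pappusGraph := by
  refine isPseudoTwoFactorIsomorphic_of_odd (hasTwoFactorWith_of_circuits pappusHam_isClosing ?_)
    fun F hF => numCircuits_pappusGraph hF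
  intro b e b' h
  rw [pappusGraph_adj]
  revert b e b'
  decide +kernel

/-- An isomorphism from `D(7)`, which has two segments and two additional vertices, to the Heawood
graph, vertex by vertex. -/
def heawoodMap : (Fin 2 × CLabel) ⊕ Fin (2 * 1) → ZMod 7 ⊕ ZMod 7
  | .inl (0, .u1) => .inr 0
  | .inl (0, .u2) => .inl 0
  | .inl (0, .u3) => .inr 4
  | .inl (0, .u4) => .inl 4
  | .inl (0, .v1) => .inl 1
  | .inl (0, .v2) => .inr 1
  | .inl (1, .u1) => .inr 5
  | .inl (1, .u2) => .inl 5
  | .inl (1, .u3) => .inr 2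
  | .inl (1, .u4) => .inl 2
  | .inl (1, .v1) => .inl 6
  | .inl (1, .v2) => .inr 6
  | .inr 0 => .inl 3
  | .inr 1 => .inr 3

instance (m r : ℕ) : DecidableRel (dRel m r)
  | .inl _, .inl _ => inferInstanceAs (Decidable (_ ∨ _))
  | .inl _, .inr _ => inferInstanceAs (Decidable (_ ∨ _))
  | .inr _, .inl _ => inferInstanceAs (Decidable False)
  | .inr _, .inr _ => inferInstanceAs (Decidable (_ = _))

theorem nonempty_graphD_seven_iso : Nonempty (graphD 7 ≃g heawoodGraph) := by
  have hbij : Function.Bijective heawoodMap :=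
    (Fintype.bijective_iff_injective_and_card _).2 ⟨by decide +kernel, rfl⟩
  have hadj : ∀ a b, heawoodMap b ∈ heawoodNbrs (heawoodMap a) ↔
      a ≠ b ∧ (dRel 2 1 a b ∨ dRel 2 1 b a) := by
    decide +kernel
  refine ⟨⟨Equiv.ofBijective heawoodMap hbij, fun {a b} => ?_⟩⟩
  exact (heawoodGraph_adj _ _).trans ((hadj a b).trans (SimpleGraph.fromRel_adj _ _ _).symm)

theorem isPseudoTwoFactorIsomorphic_heawoodGraph : IsPseudoTwoFactorIsomorphic heawoodGraph := by
  obtain ⟨f⟩ := nonempty_graphD_seven_iso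
  have h : HasTwoFactorWith (graphD 7) 1 := dHam1_isClosingD.hasTwoFactorWith (by decide) 1
  exact isPseudoTwoFactorIsomorphic_of_odd (h.of_iso f.symm) fun F hF => numCircuits_heawoodGraph hF

/-! ### The classification -/

theorem hasTwoFactorWith_dRel {m r : ℕ} (hr : r < 3) (h : 7 < 3 * m + r) :
    HasTwoFactorWith (SimpleGraph.fromRel (dRel m r)) 1 ∧
      HasTwoFactorWith (SimpleGraph.fromRel (dRel m r)) 2 := by
  interval_cases r
  · obtain ⟨k, rfl⟩ : ∃ k, m = k + 3 := ⟨m - 3, by omega⟩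
    exact ⟨dHam0_isClosingD.hasTwoFactorWith hr (k + 1), dTwo0_isClosingD.hasTwoFactorWith hr k⟩
  · obtain ⟨k, rfl⟩ : ∃ k, m = k + 3 := ⟨m - 3, by omega⟩
    refine ⟨dHam1_isClosingD.hasTwoFactorWith hr (k + 2), ?_⟩
    cases k with
    | zero =>
      refine hasTwoFactorWith_of_circuits dTwo10_isClosing fun b e b' h => ?_
      rw [SimpleGraph.fromRel_adj]
      revert b e b'
      decide +kernel
    | succ k =>
      have := dTwo1_isClosingD.hasTwoFactorWith hr k
      rwa [show k + (3 + 1) = k + 1 + 3 by omega] at this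
  · obtain ⟨k, rfl⟩ : ∃ k, m = k + 1 := ⟨m - 1, by omega⟩
    exact ⟨dHam2_isClosingD.hasTwoFactorWith hr k, dTwo2_isClosingD.hasTwoFactorWith hr k⟩

theorem hasTwoFactorWith_of_inInfiniteFamilies {V : Type*} {G : SimpleGraph V}
    (h : InInfiniteFamilies G) (hG : IsEmpty (G ≃g heawoodGraph)) :
    HasTwoFactorWith G 1 ∧ HasTwoFactorWith G 2 := by
  rcases h with ⟨n, hn, ⟨f⟩⟩ | ⟨n, hn, ⟨f⟩⟩ | ⟨n, hn, ⟨f⟩⟩ | ⟨n, hn, ⟨f⟩⟩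
  · have hn7 : n ≠ 7 := by
      rintro rfl
      obtain ⟨g⟩ := nonempty_graphD_seven_iso
      exact hG.elim (f.trans g)
    obtain ⟨h₁, h₂⟩ := hasTwoFactorWith_dRel (m := n / 3) (r := n % 3) (by omega) (by omega)
    exact ⟨h₁.of_iso f, h₂.of_iso f⟩
  all_goals obtain ⟨k, rfl⟩ : ∃ k, n = k + 1 := ⟨n - 1, by omega⟩
  · exact ⟨.of_iso f (t1Ham_isClosingT.hasTwoFactorWith k),
      .of_iso f (t1Two_isClosingT.hasTwoFactorWith k)⟩
  · exact ⟨.of_iso f (t2Ham_isClosingT.hasTwoFactorWith k),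
      .of_iso f (t2Two_isClosingT.hasTwoFactorWith k)⟩
  · exact ⟨.of_iso f (t3Ham_isClosingT.hasTwoFactorWith k),
      .of_iso f (t3Two_isClosingT.hasTwoFactorWith k)⟩

theorem theorem3p1 {V : Type*} (G : SimpleGraph V) :
    (IsIrreducibleLeviGraph G ∧ IsPseudoTwoFactorIsomorphic G ↔
      Nonempty (G ≃g heawoodGraph) ∨ Nonempty (G ≃g pappusGraph)) ∧
    (InInfiniteFamilies G → IsEmpty (G ≃g heawoodGraph) →
      (∃ F : SimpleGraph V, IsTwoFactor G F ∧ F.Connected) ∧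
      (∃ F : SimpleGraph V, IsTwoFactor G F ∧ numCircuits F = 2)) := by
  refine ⟨⟨?_, ?_⟩, fun hG hH => ?_⟩
  · rintro ⟨hG | hG, -, hparity⟩
    · by_contra! h
      obtain ⟨⟨F₁, hF₁, h₁⟩, F₂, hF₂, h₂⟩ :=
        hasTwoFactorWith_of_inInfiniteFamilies hG h.1
      have := hparity F₁ F₂ hF₁ hF₂
      rw [h₁, h₂] at this
      exact absurd this (by decide)
    · exact .inr hG
  · rintro (⟨⟨f⟩⟩ | ⟨⟨f⟩⟩)
    · obtain ⟨g⟩ := nonempty_graphD_seven_iso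
      exact ⟨.inl (.inl ⟨7, le_rfl, ⟨f.trans g.symm⟩⟩),
        isPseudoTwoFactorIsomorphic_heawoodGraph.of_iso f⟩
    · exact ⟨.inr ⟨f⟩, isPseudoTwoFactorIsomorphic_pappusGraph.of_iso f⟩
  · obtain ⟨⟨F₁, hF₁, h₁⟩, h₂⟩ := hasTwoFactorWith_of_inInfiniteFamilies hG hH
    exact ⟨⟨F₁, hF₁, connected_of_numCircuits_eq_one h₁⟩, h₂⟩
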